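/- For a finite simple graph $G$ with vertex set $V$, $|V|=d$, let $P(G)=\{x\in[0,1]^V : x_v+x_w\le 1 \text{ for every edge } vw \text{ of } G\}\subset\mathbb{R}^V$ be its graph polytope. For a polytope $S\subset\mathbb{R}^V$ let $L_S(t)=|tS\cap\mathbb{Z}^V|$ for integers $t\ge 1$, and let $\mathrm{Ehr}_S(z)=1+\sum_{t\ge1}L_S(t)z^t$ be its Ehrhart series. The $h^*$-polynomial of $P(G)$ is the polynomial $h\in\mathbb{Z}[z]$ with $$\mathrm{Ehr}_{P(G)}(z)=\frac{h(z)}{(1-z)^{d+1}},$$ which is unique if it exists. A polynomial $p$ of degree $n$ is called palindromic if $z^n p(1/z)=p(z)$. **Theorem.** (a) Let $G$ be a finite simple bipartite graph with $d\ge1$ vertices and without isolated vertices (so that $d\ge2$). Then the $h^*$-polynomial of $P(G)$ exists and is a palindromic polynomial of degree exactly $d-2$. (b) (Conjecture 1 of OEIS A205497.) For every integer $n\ge0$ let $L_n$ be the path graph with vertices $1,\dots,n$ and edges $\{i,i+1\}$, $1\le i\le n-1$. Then the $h^*$-polynomial $h_n$ of $P(L_n)$ exists and is palindromic, of degree $n-2$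 if $n\ge2$ and of degree $0$ if $n\in\{0,1\}$. -/

import Mathlib

/-- The graph polytope `P(G)`: the points of the unit cube, with coordinates indexed by the
vertices of `G`, such that `x v + x w ≤ 1` for every edge `vw` of `G`. -/
def graphPolytope {V : Type*} (G : SimpleGraph V) : Set (V → ℝ) :=
  {x | (∀ v, x v ∈ Set.Icc (0 : ℝ) 1) ∧ ∀ v w, G.Adj v w → x v + x w ≤ 1}

open scoped Pointwise in
/-- The number `L_S(t)` of integer points of the dilate `tS`. (The set counted is finite
when `S` is bounded.) -/
noncomputable def latticeCount {V : Type*} (S : Set (V → ℝ)) (t : ℕ) : ℕ :=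
  {m : V → ℤ | (fun v => (m v : ℝ)) ∈ (t : ℝ) • S}.ncard

/-- The Ehrhart series `1 + ∑_{t ≥ 1} L_S(t) z^t`. -/
noncomputable def ehrhartSeries {V : Type*} (S : Set (V → ℝ)) : PowerSeries ℤ :=
  PowerSeries.mk fun t => if t = 0 then 1 else (latticeCount S t : ℤ)

/-- `h` is the `h*`-polynomial of the full-dimensional polytope `S` in `ℝ^V`, where `V` has `d`
elements: the Ehrhart series of `S` is `h(z) / (1 - z)^(d+1)`. Since `1 - z` is invertible as a
power series, there is at most one such `h`. -/
def IsHStarPolynomial {V : Type*} [Fintype V] (S : Set (V → ℝ)) (h : Polynomial ℤ) : Prop :=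
  (h : PowerSeries ℤ) = ehrhartSeries S * (1 - PowerSeries.X) ^ (Fintype.card V + 1)

/-- `p` has degree exactly `n` and `z^n p(1/z) = p(z)`. -/
def IsPalindromicOfDegree (p : Polynomial ℤ) (n : ℕ) : Prop :=
  p.degree = (n : WithBot ℕ) ∧ Polynomial.reflect n p = p

/-!
Reflecting `x v ↦ t - x v` on one colour class turns the lattice points of `t P(G)`, for bipartite
`G`, into the weakly order-preserving maps to `{0, …, t}` on the poset of height two whose
relations are the edges of `G`. Sorting the values of such a map and breaking ties by a fixed
labelling (Stanley's `(P, ω)`-partitions) splits these maps according to linear extensions, so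
that the Ehrhart series is `W(z) / (1 - z)^(d+1)`, where `W` counts linear extensions by
descents. Reversing the labelling replaces weak inequalities by strict ones and `k` descents by
`d - 1 - k`. If every vertex has a neighbour, adding `1` on the upper colour class is a bijection
from the weak maps bounded by `t` to the strict ones bounded by `t + 1`, so
`z^(d-1) W(1/z) = z W(z)`. As `W(0) = 1`, this is palindromicity with degree exactly `d - 2`.
-/

theorem isPalindromicOfDegree_of_reflect_succ {n : ℕ} {p : Polynomial ℤ}
    (hp : p.natDegree ≤ n + 1) (h0 : p.coeff 0 ≠ 0)
    (h : Polynomial.reflect (n + 1) p = Polynomial.X * p) : IsPalindromicOfDegree p n := by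
  have htop : p.coeff (n + 1) = 0 := by
    simpa [Polynomial.coeff_reflect] using congrArg (Polynomial.coeff · 0) h
  have hle : p.natDegree ≤ n := Polynomial.natDegree_le_pred hp htop
  have hrefl : Polynomial.reflect n p = p := by
    refine mul_left_cancel₀ Polynomial.X_ne_zero (Eq.trans ?_ h)
    simpa [add_comm] using (Polynomial.reflect_mul (1 : Polynomial ℤ) p (F := 1) (by simp) hle).symm
  have hlead : p.coeff n = p.coeff 0 := by
    conv_rhs => rw [← hrefl, Polynomial.coeff_reflect, Polynomial.revAt_zero]
  exact ⟨Polynomial.degree_eq_of_le_of_coeff_ne_zero (Polynomial.degree_le_of_natDegree_le hle)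
    (hlead ▸ h0), hrefl⟩

section Descents

variable {κ : Type*} [LinearOrder κ] {n : ℕ}

/-- The positions `i` at which the word `a 0, …, a (n - 1)` descends from letter `i` to letter
`i + 1`. They range over `Fin (n - 1)`, so the empty word has none. -/
def descents (a : Fin n → κ) : Finset (Fin (n - 1)) :=
  {i | a ⟨i + 1, by omega⟩ < a ⟨i, by omega⟩}

theorem card_descents_le (a : Fin n → κ) : (descents a).card ≤ n - 1 := by
  simpa using (descents a).card_le_univ

theorem card_descents_castSucc (a : Fin (n + 2) → κ) :
    (descents a).card = (descents (a ∘ Fin.castSucc)).card +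
      if a (Fin.last (n + 1)) < a (Fin.last n).castSucc then 1 else 0 := by
  simp only [descents, Finset.card_filter]
  exact Fin.sum_univ_castSucc (n := n) _

theorem card_descents_toDual_comp {a : Fin n → κ} (ha : Function.Injective a) :
    (descents (OrderDual.toDual ∘ a)).card = n - 1 - (descents a).card := by
  have hcompl : descents (OrderDual.toDual ∘ a) = (descents a)ᶜ := by
    ext i
    simp [descents, le_iff_lt_or_eq, ha.eq_iff]
  rw [hcompl, Finset.card_compl, Fintype.card_fin]

end Descents

section LabelledPartitions

variable {V κ : Type*} [Fintype V] [LinearOrder κ] {R : V → V → Prop} {ω : V → κ} {t : ℕ}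
  {f : V → ℕ}

open Classical in
/-- Stanley's `(P, ω)`-partitions with parts at most `t`, for a relation `R` and a labelling `ω`:
the maps `f` that weakly increase along `R`, and strictly so wherever the label decreases. For
an irreflexive `R` and an injective `ω` this says that the pair `(f v, ω v)` increases
lexicographically, which is the condition used here. -/
noncomputable def labelledPartitions (R : V → V → Prop) (ω : V → κ) (t : ℕ) :
    Finset (V → ℕ) :=
  {f ∈ Fintype.piFinset fun _ => Finset.range (t + 1) |
    ∀ v w, R v w → toLex (f v, ω v) < toLex (f w, ω w)}

theorem mem_labelledPartitions :
    f ∈ labelledPartitions R ω t ↔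
      (∀ v, f v ≤ t) ∧ ∀ v w, R v w → toLex (f v, ω v) < toLex (f w, ω w) := by
  simp [labelledPartitions]

theorem mem_labelledPartitions_of_natural (hω : ∀ v w, R v w → ω v < ω w) :
    f ∈ labelledPartitions R ω t ↔ (∀ v, f v ≤ t) ∧ ∀ v w, R v w → f v ≤ f w := by
  refine mem_labelledPartitions.trans (and_congr_right' (forall₃_congr fun v w h => ?_))
  simp [Prod.Lex.toLex_lt_toLex, hω v w h, le_iff_lt_or_eq]

theorem mem_labelledPartitions_toDual_of_natural (hω : ∀ v w, R v w → ω v < ω w) :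
    f ∈ labelledPartitions R (OrderDual.toDual ∘ ω) t ↔
      (∀ v, f v ≤ t) ∧ ∀ v w, R v w → f v < f w := by
  refine mem_labelledPartitions.trans (and_congr_right' (forall₃_congr fun v w h => ?_))
  simp [Prod.Lex.toLex_lt_toLex, (hω v w h).not_gt]

theorem labelledPartitions_zero_of_natural (hω : ∀ v w, R v w → ω v < ω w) :
    labelledPartitions R ω 0 = {0} := by
  ext f
  simp only [mem_labelledPartitions_of_natural hω, Nat.le_zero, Finset.mem_singleton, funext_iff,
    Pi.zero_apply, and_iff_left_iff_imp]
  exact fun hf v w _ => by rw [hf v, hf w]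

/-- The generating function of the number of labelled partitions by the bound on their parts. -/
noncomputable def partitionSeries (R : V → V → Prop) (ω : V → κ) : PowerSeries ℤ :=
  PowerSeries.mk fun t => ((labelledPartitions R ω t).card : ℤ)

end LabelledPartitions

section Chains

variable {κ : Type*} [LinearOrder κ] {n : ℕ}

theorem mem_labelledPartitions_chain {a : Fin (n + 1) → κ} (ha : Function.Injective a) {t : ℕ}
    {f : Fin (n + 1) → ℕ} :
    f ∈ labelledPartitions (· < ·) a t ↔ f (Fin.last n) ≤ t ∧
      ∀ i : Fin n, f i.castSucc + (if a i.succ < a i.castSucc then 1 else 0) ≤ f i.succ := by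
  have hstep (i : Fin n) : toLex (f i.castSucc, a i.castSucc) < toLex (f i.succ, a i.succ) ↔
      f i.castSucc + (if a i.succ < a i.castSucc then 1 else 0) ≤ f i.succ := by
    have hne : a i.castSucc ≠ a i.succ := ha.ne Fin.castSucc_lt_succ.ne
    rw [Prod.Lex.toLex_lt_toLex]
    split_ifs with h
    · simp [h.not_gt]
    · simp [hne.lt_of_le (not_lt.1 h), le_iff_lt_or_eq]
  rw [mem_labelledPartitions, ← forall_congr' hstep,
    ← Fin.strictMono_iff_lt_succ (f := fun i => toLex (f i, a i))]
  refine and_congr_left fun hf => ⟨fun h => h _, fun h i => ?_⟩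
  have hmono : StrictMono fun i => toLex (f i, a i) := hf
  exact (Prod.Lex.monotone_fst _ _ (hmono.monotone (Fin.le_last i))).trans h

theorem coeff_partitionSeries_chain_mul_one_sub {a : Fin (n + 1) → κ}
    (ha : Function.Injective a) (t : ℕ) :
    PowerSeries.coeff t (partitionSeries (· < ·) a * (1 - PowerSeries.X)) =
      (((labelledPartitions (· < ·) a t).filter fun f => f (Fin.last n) = t).card : ℤ) := by
  rw [mul_sub, mul_one, map_sub, partitionSeries, PowerSeries.coeff_mk]
  cases t with
  | zero =>
    rw [PowerSeries.coeff_zero_mul_X, sub_zero, Finset.filter_true_of_mem]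
    exact fun f hf => Nat.le_zero.1 ((mem_labelledPartitions_chain ha).1 hf).1
  | succ t =>
    have hlower : ((labelledPartitions (· < ·) a (t + 1)).filter
        fun f => ¬ f (Fin.last n) = t + 1) = labelledPartitions (· < ·) a t := by
      ext f
      simp only [Finset.mem_filter, mem_labelledPartitions_chain ha]
      grind
    rw [PowerSeries.coeff_succ_mul_X, PowerSeries.coeff_mk, ← hlower,
      ← Finset.card_filter_add_card_filter_not fun f => f (Fin.last n) = t + 1]
    push_cast
    ring

theorem card_labelledPartitions_chain_last_eq {a : Fin (n + 2) → κ} (ha : Function.Injective a)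
    {t δ : ℕ} (hδ : δ = if a (Fin.last (n + 1)) < a (Fin.last n).castSucc then 1 else 0) :
    ((labelledPartitions (· < ·) a t).filter fun f => f (Fin.last (n + 1)) = t).card =
      if δ ≤ t then (labelledPartitions (· < ·) (a ∘ Fin.castSucc) (t - δ)).card else 0 := by
  have hmem (f : Fin (n + 2) → ℕ) : f ∈ labelledPartitions (· < ·) a t ∧ f (Fin.last _) = t ↔
      δ ≤ t ∧ f ∘ Fin.castSucc ∈ labelledPartitions (· < ·) (a ∘ Fin.castSucc) (t - δ) ∧
        f (Fin.last _) = t := by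
    rw [mem_labelledPartitions_chain ha, mem_labelledPartitions_chain
      (ha.comp (Fin.castSucc_injective _)), Fin.forall_fin_succ']
    simp only [Function.comp_apply, Fin.succ_last, Fin.succ_castSucc, ← hδ]
    grind
  split_ifs with hδt
  · refine Finset.card_nbij' (fun f => f ∘ Fin.castSucc) (fun g => Fin.snoc g t) ?_ ?_ ?_ ?_
    · exact fun f hf => ((hmem f).1 (Finset.mem_filter.1 hf)).2.1
    · intro g hg
      refine Finset.mem_filter.2 ((hmem _).2 ⟨hδt, ?_, Fin.snoc_last _ _⟩)
      rwa [Fin.snoc_comp_castSucc]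
    · intro f hf
      rw [← (Finset.mem_filter.1 hf).2]
      exact Fin.snoc_init_self f
    · exact fun g _ => Fin.snoc_comp_castSucc
  · rw [Finset.card_eq_zero, Finset.filter_eq_empty_iff]
    exact fun f hf hlast => hδt ((hmem f).1 ⟨hf, hlast⟩).1

theorem partitionSeries_chain_succ {a : Fin (n + 2) → κ} (ha : Function.Injective a) :
    partitionSeries (· < ·) a * (1 - PowerSeries.X) =
      PowerSeries.X ^ (if a (Fin.last (n + 1)) < a (Fin.last n).castSucc then 1 else 0) *
        partitionSeries (· < ·) (a ∘ Fin.castSucc) := by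
  ext t
  rw [coeff_partitionSeries_chain_mul_one_sub ha, card_labelledPartitions_chain_last_eq ha rfl,
    PowerSeries.coeff_X_pow_mul', partitionSeries, PowerSeries.coeff_mk, Nat.cast_ite,
    Nat.cast_zero]

theorem partitionSeries_chain_zero (a : Fin 0 → κ) :
    partitionSeries (· < ·) a = PowerSeries.mk 1 := by
  ext t
  simp [partitionSeries, labelledPartitions]

theorem partitionSeries_chain_one (a : Fin 1 → κ) :
    partitionSeries (· < ·) a * (1 - PowerSeries.X) = PowerSeries.mk 1 := by
  ext t
  have ha : Function.Injective a := Function.injective_of_subsingleton a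
  have hunique : ((labelledPartitions (· < ·) a t).filter fun f => f (Fin.last 0) = t) =
      {fun _ => t} := by
    ext f
    simp +contextual [mem_labelledPartitions_chain ha, funext_iff]
  rw [coeff_partitionSeries_chain_mul_one_sub ha, hunique]
  simp

theorem partitionSeries_chain_mul_one_sub_pow : ∀ {n : ℕ} {a : Fin n → κ},
    Function.Injective a → partitionSeries (· < ·) a * (1 - PowerSeries.X) ^ (n + 1) =
      PowerSeries.X ^ (descents a).card
  | 0, a, _ => by
    rw [partitionSeries_chain_zero, pow_one, PowerSeries.mk_one_mul_one_sub_eq_one]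
    simp [descents]
  | 1, a, _ => by
    rw [pow_succ', pow_one, ← mul_assoc, partitionSeries_chain_one,
      PowerSeries.mk_one_mul_one_sub_eq_one]
    simp [descents]
  | n + 2, a, ha => by
    rw [pow_succ', ← mul_assoc, partitionSeries_chain_succ ha, mul_assoc,
      partitionSeries_chain_mul_one_sub_pow (ha.comp (Fin.castSucc_injective _)),
      card_descents_castSucc, ← pow_add, add_comm]

end Chains

section LinearExtensions

variable {V κ : Type*} [Fintype V] [LinearOrder κ] {R : V → V → Prop} {ω : V → κ}

theorem existsUnique_strictMono_comp_equiv {α : Type*} [LinearOrder α] {x : V → α}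
    (hx : Function.Injective x) : ∃! σ : Fin (Fintype.card V) ≃ V, StrictMono (x ∘ σ) := by
  let e := (Fintype.equivFin V).symm
  let σ₀ := (Tuple.sort (x ∘ e)).trans e
  have hσ₀ : StrictMono (x ∘ σ₀) :=
    (Tuple.monotone_sort (x ∘ e)).strictMono_of_injective (hx.comp σ₀.injective)
  refine ⟨σ₀, hσ₀, fun σ hσ => Equiv.ext fun i => hx ?_⟩
  have hrange : Set.range (x ∘ σ) = Set.range (x ∘ σ₀) := by
    simp only [Set.range_comp, Equiv.range_eq_univ]
  exact congrFun ((hσ.range_inj hσ₀).1 hrange) i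

open Classical in
/-- The linear extensions of `R`, written as words in the elements of `V`. -/
noncomputable def linearExtensions (R : V → V → Prop) : Finset (Fin (Fintype.card V) ≃ V) :=
  {σ | ∀ v w, R v w → σ.symm v < σ.symm w}

theorem mem_linearExtensions {σ : Fin (Fintype.card V) ≃ V} :
    σ ∈ linearExtensions R ↔ ∀ v w, R v w → σ.symm v < σ.symm w := by
  simp [linearExtensions]

theorem card_labelledPartitions_eq_sum_linearExtensions (hω : Function.Injective ω) (t : ℕ) :
    (labelledPartitions R ω t).card =
      ∑ σ ∈ linearExtensions R, (labelledPartitions (· < ·) (ω ∘ σ) t).card := by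
  rw [← Finset.card_sigma, eq_comm]
  have hsort (f : V → ℕ) := existsUnique_strictMono_comp_equiv (x := fun v => toLex (f v, ω v))
    fun v w h => hω (congrArg (fun x => (ofLex x).2) h)
  refine Finset.card_nbij (fun p => p.2 ∘ p.1.symm) ?_ ?_ ?_
  · rintro ⟨σ, g⟩ hσg
    obtain ⟨hσ, hg⟩ := Finset.mem_sigma.1 hσg
    rw [mem_linearExtensions] at hσ
    rw [mem_labelledPartitions] at hg
    refine mem_labelledPartitions.2 ⟨fun v => hg.1 _, fun v w h => ?_⟩
    simpa using hg.2 _ _ (hσ v w h)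
  · rintro ⟨σ, g⟩ hσg ⟨τ, h⟩ hτh heq
    have hσ := (mem_labelledPartitions.1 (Finset.mem_sigma.1 hσg).2).2
    have hτ := (mem_labelledPartitions.1 (Finset.mem_sigma.1 hτh).2).2
    simp only at heq
    obtain rfl : σ = τ := by
      refine (hsort (g ∘ σ.symm)).unique (fun i j hij => ?_) (fun i j hij => ?_)
      · simpa using hσ i j hij
      · rw [heq]
        simpa using hτ i j hij
    rw [σ.symm.surjective.injective_comp_right heq]
  · intro f hf
    obtain ⟨hbound, hrel⟩ := mem_labelledPartitions.1 hf
    obtain ⟨σ, hσ, -⟩ := hsort f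
    refine ⟨⟨σ, f ∘ σ⟩, Finset.mem_sigma.2 ⟨?_, ?_⟩, ?_⟩
    · refine mem_linearExtensions.2 fun v w h => hσ.lt_iff_lt.1 ?_
      simpa using hrel v w h
    · exact mem_labelledPartitions.2 ⟨fun i => hbound _, fun i j hij => hσ hij⟩
    · ext v
      simp

/-- The sum of `X ^ des (ω ∘ σ)` over the linear extensions `σ` of `R`: Stanley's `W`-polynomial
of the labelled poset `(R, ω)`. -/
noncomputable def descentPolynomial (R : V → V → Prop) (ω : V → κ) : Polynomial ℤ :=
  ∑ σ ∈ linearExtensions R, Polynomial.X ^ (descents (ω ∘ σ)).card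

theorem partitionSeries_mul_one_sub_pow (hω : Function.Injective ω) :
    partitionSeries R ω * (1 - PowerSeries.X) ^ (Fintype.card V + 1) =
      (descentPolynomial R ω : PowerSeries ℤ) := by
  have hsum : partitionSeries R ω =
      ∑ σ ∈ linearExtensions R, partitionSeries (· < ·) (ω ∘ σ) := by
    ext t
    simp [partitionSeries, card_labelledPartitions_eq_sum_linearExtensions hω]
  rw [hsum, Finset.sum_mul, descentPolynomial, ← Polynomial.coeToPowerSeries.ringHom_apply,
    map_sum]
  refine Finset.sum_congr rfl fun σ _ => ?_
  rw [partitionSeries_chain_mul_one_sub_pow (hω.comp σ.injective)]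
  simp

theorem natDegree_descentPolynomial_le :
    (descentPolynomial R ω).natDegree ≤ Fintype.card V - 1 := by
  refine Polynomial.natDegree_sum_le_of_forall_le _ _ fun σ _ => ?_
  rw [Polynomial.natDegree_X_pow]
  exact card_descents_le _

theorem coeff_zero_descentPolynomial (hω : Function.Injective ω)
    (hR : ∀ v w, R v w → ω v < ω w) : (descentPolynomial R ω).coeff 0 = 1 := by
  rw [← Polynomial.coeff_coe, ← partitionSeries_mul_one_sub_pow hω]
  simp [partitionSeries, labelledPartitions_zero_of_natural hR]

theorem reflect_descentPolynomial (hω : Function.Injective ω) :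
    Polynomial.reflect (Fintype.card V - 1) (descentPolynomial R ω) =
      descentPolynomial R (OrderDual.toDual ∘ ω) := by
  ext k
  simp only [descentPolynomial, Polynomial.coeff_reflect, Polynomial.finsetSum_coeff]
  refine Finset.sum_congr rfl fun σ _ => ?_
  rw [← Polynomial.coeff_reflect, Polynomial.reflect_monomial,
    Polynomial.revAt_le (card_descents_le _), Function.comp_assoc,
    card_descents_toDual_comp (hω.comp σ.injective)]

theorem isPalindromicOfDegree_descentPolynomial_of_subsingleton [Subsingleton V]
    (hR : ∀ v w, R v w → ω v < ω w) :
    IsPalindromicOfDegree (descentPolynomial R ω) 0 := by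
  have hdeg : (descentPolynomial R ω).natDegree ≤ 0 :=
    natDegree_descentPolynomial_le.trans
      (Nat.sub_eq_zero_of_le (Fintype.card_le_one_iff_subsingleton.2 ‹_›)).le
  rw [Polynomial.eq_C_of_natDegree_le_zero hdeg,
    coeff_zero_descentPolynomial (Function.injective_of_subsingleton ω) hR]
  exact ⟨by simp, by simp⟩

end LinearExtensions

section BipartiteGraphs

variable {V : Type*} {G : SimpleGraph V}

/-- The relation that directs each edge of `G` from its vertex of colour `false` to its vertex of
colour `true`. -/
def ColorLT (C : G.Coloring Bool) (v w : V) : Prop :=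
  G.Adj v w ∧ C v = false ∧ C w = true

/-- A labelling of the vertices by distinct labels that increases along `ColorLT C`: first by
colour, then by an arbitrary enumeration. -/
noncomputable def colorLabel [Fintype V] (C : G.Coloring Bool) (v : V) :
    Bool ×ₗ Fin (Fintype.card V) :=
  toLex (C v, Fintype.equivFin V v)

theorem colorLabel_injective [Fintype V] (C : G.Coloring Bool) :
    Function.Injective (colorLabel C) := fun _ _ h =>
  (Fintype.equivFin V).injective (congrArg (fun x => (ofLex x).2) h)

theorem ColorLT.colorLabel_lt [Fintype V] {C : G.Coloring Bool} {v w : V} (h : ColorLT C v w) :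
    colorLabel C v < colorLabel C w := by
  simp [colorLabel, Prod.Lex.toLex_lt_toLex, h.2.1, h.2.2]

theorem colorLT_of_adj_of_false {C : G.Coloring Bool} {v w : V} (h : G.Adj v w)
    (hv : C v = false) : ColorLT C v w :=
  ⟨h, hv, by simpa [hv] using (C.valid h).symm⟩

theorem colorLT_of_adj_of_true {C : G.Coloring Bool} {v w : V} (h : G.Adj v w)
    (hv : C v = true) : ColorLT C w v :=
  ⟨h.symm, by simpa [hv] using (C.valid h).symm, hv⟩

open scoped Pointwise in
theorem intCast_mem_smul_graphPolytope_iff {t : ℕ} (ht : t ≠ 0) {m : V → ℤ} :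
    (fun v => (m v : ℝ)) ∈ (t : ℝ) • graphPolytope G ↔
      (∀ v, 0 ≤ m v ∧ m v ≤ t) ∧ ∀ v w, G.Adj v w → m v + m w ≤ t := by
  have ht' : (0 : ℝ) < t := by positivity
  rw [Set.mem_smul_set_iff_inv_smul_mem₀ ht'.ne']
  simp only [graphPolytope, Set.mem_ofPred_eq, Pi.smul_apply, smul_eq_mul, Set.mem_Icc,
    ← mul_add, inv_mul_le_one₀ ht', mul_nonneg_iff_of_pos_left (inv_pos.2 ht')]
  norm_cast

theorem latticeCount_graphPolytope [Fintype V] {κ : Type*} [LinearOrder κ] {C : G.Coloring Bool}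
    {ω : V → κ} (hω : ∀ v w, ColorLT C v w → ω v < ω w) {t : ℕ} (ht : t ≠ 0) :
    latticeCount (graphPolytope G) t = (labelledPartitions (ColorLT C) ω t).card := by
  have hpoint (m : V → ℤ) := intCast_mem_smul_graphPolytope_iff (G := G) ht (m := m)
  have hpart (f : V → ℕ) := mem_labelledPartitions_of_natural hω (t := t) (f := f)
  rw [latticeCount, ← Set.ncard_coe_finset]
  refine (Set.InvOn.bijOn
    (f := fun (m : V → ℤ) v => (if C v then (t : ℤ) - m v else m v).toNat)
    (f' := fun (f : V → ℕ) v => if C v then (t : ℤ) - f v else f v)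
    ⟨fun m hm => ?_, fun f hf => ?_⟩ (fun m hm => ?_) (fun f hf => ?_)).ncard_eq
  · ext v
    have := ((hpoint m).1 hm).1 v
    grind
  · ext v
    have := ((hpart f).1 hf).1 v
    grind
  · obtain ⟨hbound, hedge⟩ := (hpoint m).1 hm
    refine (hpart _).2 ⟨fun v => ?_, fun v w h => ?_⟩
    · have := hbound v
      grind
    · have := hedge v w h.1
      simp only [h.2.1, h.2.2]
      grind
  · obtain ⟨hbound, hrel⟩ := (hpart f).1 hf
    refine (hpoint _).2 ⟨fun v => ?_, fun v w h => ?_⟩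
    · have := hbound v
      grind
    · cases hv : C v
      · have hvw := colorLT_of_adj_of_false h hv
        have := hrel v w hvw
        grind [hvw.2.2]
      · have hwv := colorLT_of_adj_of_true h hv
        have := hrel w v hwv
        grind [hwv.2.1]

theorem isHStarPolynomial_descentPolynomial [Fintype V] {κ : Type*} [LinearOrder κ]
    {C : G.Coloring Bool} {ω : V → κ} (hinj : Function.Injective ω)
    (hω : ∀ v w, ColorLT C v w → ω v < ω w) :
    IsHStarPolynomial (graphPolytope G) (descentPolynomial (ColorLT C) ω) := by
  rw [IsHStarPolynomial, ← partitionSeries_mul_one_sub_pow hinj]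
  congr 1
  ext t
  simp only [ehrhartSeries, partitionSeries, PowerSeries.coeff_mk]
  split_ifs with ht
  · simp [ht, labelledPartitions_zero_of_natural hω]
  · rw [latticeCount_graphPolytope hω ht]

theorem card_labelledPartitions_toDual_succ [Fintype V] {κ : Type*} [LinearOrder κ]
    {C : G.Coloring Bool} {ω : V → κ} (hω : ∀ v w, ColorLT C v w → ω v < ω w)
    (hG : ∀ v, ∃ w, G.Adj v w) (t : ℕ) :
    (labelledPartitions (ColorLT C) (OrderDual.toDual ∘ ω) (t + 1)).card =
      (labelledPartitions (ColorLT C) ω t).card := by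
  have hparts {f : V → ℕ} (hf : f ∈ labelledPartitions (ColorLT C) (OrderDual.toDual ∘ ω) (t + 1))
      (v : V) : (C v).toNat ≤ f v ∧ f v ≤ t + (C v).toNat := by
    rw [mem_labelledPartitions_toDual_of_natural hω] at hf
    obtain ⟨w, hvw⟩ := hG v
    have hv := hf.1 v
    have hw := hf.1 w
    cases hC : C v
    · have := hf.2 v w (colorLT_of_adj_of_false hvw hC)
      simp only [Bool.toNat_false]
      omega
    · have := hf.2 w v (colorLT_of_adj_of_true hvw hC)
      simp only [Bool.toNat_true]
      omega
  refine Finset.card_nbij' (fun f v => f v - (C v).toNat) (fun f v => f v + (C v).toNat)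
    (fun f hf => ?_) (fun f hf => ?_) (fun f hf => ?_) (fun f _ => ?_)
  · have hf' := (mem_labelledPartitions_toDual_of_natural hω).1 hf
    refine (mem_labelledPartitions_of_natural hω).2 ⟨fun v => ?_, fun v w h => ?_⟩
    · exact Nat.sub_le_iff_le_add.2 (hparts hf v).2
    · have := hf'.2 v w h
      simp only [h.2.1, h.2.2, Bool.toNat_false, Bool.toNat_true]
      omega
  · have hf' := (mem_labelledPartitions_of_natural hω).1 hf
    refine (mem_labelledPartitions_toDual_of_natural hω).2 ⟨fun v => ?_, fun v w h => ?_⟩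
    · exact add_le_add (hf'.1 v) (C v).toNat_le
    · have := hf'.2 v w h
      simp only [h.2.1, h.2.2, Bool.toNat_false, Bool.toNat_true]
      omega
  · exact funext fun v => Nat.sub_add_cancel (hparts hf v).1
  · exact funext fun v => Nat.add_sub_cancel _ _

theorem partitionSeries_toDual_eq_X_mul [Fintype V] [Nonempty V] {κ : Type*} [LinearOrder κ]
    {C : G.Coloring Bool} {ω : V → κ} (hω : ∀ v w, ColorLT C v w → ω v < ω w)
    (hG : ∀ v, ∃ w, G.Adj v w) :
    partitionSeries (ColorLT C) (OrderDual.toDual ∘ ω) =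
      PowerSeries.X * partitionSeries (ColorLT C) ω := by
  ext t
  cases t with
  | zero =>
    obtain ⟨v, w, hvw⟩ : ∃ v w, ColorLT C v w := by
      obtain ⟨v⟩ := ‹Nonempty V›
      obtain ⟨w, h⟩ := hG v
      cases hv : C v
      · exact ⟨v, w, colorLT_of_adj_of_false h hv⟩
      · exact ⟨w, v, colorLT_of_adj_of_true h hv⟩
    have hempty : labelledPartitions (ColorLT C) (OrderDual.toDual ∘ ω) 0 = ∅ := by
      refine Finset.eq_empty_of_forall_notMem fun f hf => ?_
      obtain ⟨hbound, hrel⟩ := (mem_labelledPartitions_toDual_of_natural hω).1 hf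
      exact absurd ((hrel v w hvw).trans_le (hbound w)) (Nat.not_lt_zero _)
    simp [partitionSeries, hempty]
  | succ t =>
    rw [PowerSeries.coeff_succ_X_mul, partitionSeries, partitionSeries, PowerSeries.coeff_mk,
      PowerSeries.coeff_mk, card_labelledPartitions_toDual_succ hω hG]

theorem isPalindromicOfDegree_descentPolynomial [Fintype V] [Nonempty V] {κ : Type*}
    [LinearOrder κ] {C : G.Coloring Bool} {ω : V → κ} (hinj : Function.Injective ω)
    (hω : ∀ v w, ColorLT C v w → ω v < ω w) (hG : ∀ v, ∃ w, G.Adj v w) :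
    IsPalindromicOfDegree (descentPolynomial (ColorLT C) ω) (Fintype.card V - 2) := by
  have hcard : Fintype.card V - 2 + 1 = Fintype.card V - 1 := by
    obtain ⟨v⟩ := ‹Nonempty V›
    obtain ⟨w, h⟩ := hG v
    have := Fintype.one_lt_card_iff.2 ⟨v, w, h.ne⟩
    omega
  refine isPalindromicOfDegree_of_reflect_succ (hcard ▸ natDegree_descentPolynomial_le) ?_ ?_
  · rw [coeff_zero_descentPolynomial hinj hω]
    exact one_ne_zero
  · apply Polynomial.coe_injective ℤ
    rw [hcard, reflect_descentPolynomial hinj, Polynomial.coe_mul, Polynomial.coe_X,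
      ← partitionSeries_mul_one_sub_pow hinj,
      ← partitionSeries_mul_one_sub_pow (OrderDual.toDual.injective.comp hinj),
      partitionSeries_toDual_eq_X_mul hω hG, mul_assoc]

end BipartiteGraphs

theorem mainTheorem1 :
    (∀ (V : Type*) [Fintype V] [Nonempty V] (G : SimpleGraph V),
      G.IsBipartite → (∀ v, ∃ w, G.Adj v w) →
        ∃ h : Polynomial ℤ, IsHStarPolynomial (graphPolytope G) h ∧
          IsPalindromicOfDegree h (Fintype.card V - 2)) ∧
    (∀ n : ℕ, ∃ h : Polynomial ℤ,
      IsHStarPolynomial (graphPolytope (SimpleGraph.pathGraph n)) h ∧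
        IsPalindromicOfDegree h (n - 2)) := by
  refine ⟨fun V _ _ G hbip hG => ?_, fun n => ?_⟩
  · let C : G.Coloring Bool := hbip.toColoring (by simp)
    exact ⟨descentPolynomial (ColorLT C) (colorLabel C),
      isHStarPolynomial_descentPolynomial (colorLabel_injective C) fun _ _ h => h.colorLabel_lt,
      isPalindromicOfDegree_descentPolynomial (colorLabel_injective C)
        (fun _ _ h => h.colorLabel_lt) hG⟩
  · let C := SimpleGraph.pathGraph.bicoloring n
    refine ⟨descentPolynomial (ColorLT C) (colorLabel C),
      isHStarPolynomial_descentPolynomial (colorLabel_injective C) fun _ _ h => h.colorLabel_lt, ?_⟩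
    rcases Nat.lt_or_ge n 2 with hn | hn
    · have := Fin.subsingleton_iff_le_one.2 (Nat.le_of_lt_succ hn)
      rw [Nat.sub_eq_zero_of_le hn.le]
      exact isPalindromicOfDegree_descentPolynomial_of_subsingleton fun _ _ h => h.colorLabel_lt
    · have := Fin.nontrivial_iff_two_le.2 hn
      have hpath := (SimpleGraph.pathGraph_preconnected n).exists_adj_of_nontrivial
      simpa using isPalindromicOfDegree_descentPolynomial (colorLabel_injective C)
        (fun _ _ h => h.colorLabel_lt) hpath
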